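/- Let $V=\{1,\dots,n\}$ be the set of mesh nodes, $n=|V|$. For $p=(p_1,\dots,p_n)\in[0,1]^n$ let $\pi$ be the law on $\{0,1\}^n$ of independent $a_i\sim\mathrm{Bernoulli}(p_i)$, and let $\psi(t)=\sum_{i=1}^{n}\log(1-p_i+p_ie^{t})$ be the cumulant generating function of $\sum_i a_i$. For $k\in\mathbb R$ with $kn\in\{0,1,2,\dots\}$, a saddle point is a solution $t^*\in\mathbb R$ of $\psi'(t^*)=kn$. Given a saddle point with $\psi''(t^*)>0$, the saddle point approximation of $\pi(\sum_i a_i=kn)$ is $$\hat\pi\Big(\sum_i a_i=kn\Big)=\frac{1}{\sqrt{2\pi\,\psi''(t^*)}}\exp\big(\psi(t^*)-kn\,t^*\big)$$ (inside the square root, $\pi$ is the number $3.14\ldots$). The corresponding approximation of the constrained probability $\pi(a\mid\sum_i a_i=kn)$ is $$\hat\pi\Big(a\,\Big|\,\sum_i a_i=kn\Big)=\frac{\pi(a)\,\mathbf 1[\sum_i a_i=kn]}{\hat\pi(\sum_i a_i=kn)},\qquad a\in\{0,1\}^n.$$ Then for every $\delta>0$ there are constants $C$ and $N$, depending only on $\delta$,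 such that for all $n\ge N$, all $p\in[0,1]^n$ and all real $k$ with $kn\in\{0,1,2,\dots\}$: 1. If $\delta\le p_i\le1-\delta$ for all $i$ and $\delta\le k\le1-\delta$, then there is exactly one saddle point $t^*$, and for every $a\in\{0,1\}^n$ $$\pi\Big(a\,\Big|\,\sum_i a_i=kn\Big)=\hat\pi\Big(a\,\Big|\,\sum_i a_i=kn\Big)\,(1-\varepsilon)\quad\text{for some real }\varepsilon\text{ with }|\varepsilon|\le\frac{C}{n}.$$ 2. For arbitrary $p\in[0,1]^n$, the same relation holds for every $a\in\{0,1\}^n$ whenever $t^*$ is a saddle point with $\psi''(t^*)\ge\delta n$. In other words, the relative error of the approximated constrained probability is $O(1/|V|)$ as $|V|\to\infty$. -/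

import Mathlib

open MeasureTheory ProbabilityTheory

noncomputable section

/-- The joint law on `{0,1}ⁿ` of independent `aᵢ ~ Bernoulli(pᵢ)`, `i = 1, …, n`
(`n` is the number of nodes). -/
def policy {n : ℕ} (p : Fin n → unitInterval) : Measure (Fin n → Fin 2) :=
  Measure.pi fun i => bernoulliMeasure (1 : Fin 2) 0 (p i)

/-- The event `∑ aᵢ = k n`. -/
def budget (n : ℕ) (k : ℝ) : Set (Fin n → Fin 2) :=
  {a | ∑ i, ((a i : ℕ) : ℝ) = k * n}

/-- The exact constrained probability `π(a | ∑ aᵢ = k n)`. -/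
def constrainedProb {n : ℕ} (p : Fin n → unitInterval) (k : ℝ) (a : Fin n → Fin 2) : ℝ :=
  (cond (policy p) (budget n k)).real {a}

/-- The cumulant generating function `ψ(t) = ∑ log (1 - pᵢ + pᵢ eᵗ)` of `∑ aᵢ`. -/
def cumulantGen {n : ℕ} (p : Fin n → unitInterval) (t : ℝ) : ℝ :=
  ∑ i, Real.log (1 - (p i : ℝ) + (p i : ℝ) * Real.exp t)

/-- `t` solves the saddle point equation `ψ'(t) = k n`. -/
def IsSaddlePoint {n : ℕ} (p : Fin n → unitInterval) (k t : ℝ) : Prop :=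
  deriv (cumulantGen p) t = k * n

/-- The saddle point approximation of the normaliser `π(∑ aᵢ = k n)`, with `t` the saddle point:
`exp (ψ(t) - k n t) / √(2 π ψ''(t))`. -/
def saddleNormaliser {n : ℕ} (p : Fin n → unitInterval) (k t : ℝ) : ℝ :=
  1 / Real.sqrt (2 * Real.pi * deriv (deriv (cumulantGen p)) t) *
    Real.exp (cumulantGen p t - k * n * t)

/-- The approximated constrained probability: in `π(a) [∑ aᵢ = k n] / π(∑ aᵢ = k n)` the
denominator is replaced by its saddle point approximation. -/
def approxConstrainedProb {n : ℕ} (p : Fin n → unitInterval) (k t : ℝ) (a : Fin n → Fin 2) : ℝ :=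
  (budget n k).indicator (fun b => (policy p).real {b}) a / saddleNormaliser p k t

end

namespace SaddlePoint

/-! The exact and approximated constrained probabilities differ only in the normaliser. Tilting by
$e^{t^*\sum a_i}$ keeps the coordinates independent and gives $\pi(\sum
a_i=m)=e^{\psi(t^*)-mt^*}Q(\sum a_i=m)$, where $Q$ has mean exactly $m=kn$ and variance
$s=\psi''(t^*)$. It remains to show $\sqrt{2\pi s}\,Q(\sum a_i=m)=1+O(1/s)$, a local limit theorem
at the mean (`abs_sqrt_mul_sumProb_sub_one_le`).

By Fourier inversion, $2\pi Q(\sum a_i=m)$ is the integral over $[-\pi,\pi]$ of the real part of a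
product of centred characteristic functions, compared with $e^{-s\theta^2/2}$. The cubic terms are
imaginary, so they enter the real part only through products of two deviations
(`abs_re_prod_sub_prod_le`). The error is $(s\theta^4+s^2\theta^6)e^{-s\theta^2/5}$ up to constants,
with integral $O(s^{-3/2})$ against a main term of order $s^{-1/2}$.

For parameters and $k$ in $[\delta,1-\delta]$, the saddle point lies in a bounded interval depending
only on $\delta$, so $s$ is at least a constant times $n$. -/

/-! ### Characteristic function of one centred Bernoulli variable -/

theorem abs_cos_sub_quadratic_le (x : ℝ) : |Real.cos x - (1 - x ^ 2 / 2)| ≤ x ^ 4 := by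
  rw [abs_le]
  have h0 := Real.one_sub_sq_div_two_le_cos (x := x)
  refine ⟨by nlinarith [sq_nonneg (x ^ 2)], ?_⟩
  rcases le_or_gt |x| 1 with h | h
  · have := (abs_le.1 (Real.cos_bound h)).2
    rw [show |x| ^ 4 = x ^ 4 by rw [← abs_pow, abs_of_nonneg (by positivity)]] at this
    nlinarith [sq_nonneg (x ^ 2)]
  · have h1 : 1 ≤ x ^ 2 := by
      rw [← sq_abs]; nlinarith
    nlinarith [Real.cos_le_one x]

theorem abs_exp_neg_sub_linear_le {y : ℝ} (hy : 0 ≤ y) : |Real.exp (-y) - (1 - y)| ≤ y ^ 2 := by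
  rw [abs_le]
  have h0 := Real.add_one_le_exp (-y)
  refine ⟨by nlinarith [sq_nonneg y], ?_⟩
  have h1 : Real.exp (-y) ≤ 1 / (1 + y) := by
    rw [Real.exp_neg, ← one_div]
    exact one_div_le_one_div_of_le (by linarith) (by linarith [Real.add_one_le_exp y])
  have h2 : 1 / (1 + y) ≤ 1 - y + y ^ 2 := by
    rw [div_le_iff₀ (by linarith)]
    nlinarith [pow_nonneg hy 3]
  linarith

/-- The characteristic function of a centred Bernoulli variable with parameter `q`. -/
noncomputable def centredChar (q θ : ℝ) : ℂ :=
  ((1 - q : ℝ) : ℂ) * Complex.exp ((-(q * θ) : ℝ) * Complex.I) +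
    (q : ℂ) * Complex.exp (((1 - q) * θ : ℝ) * Complex.I)

theorem centredChar_re (q θ : ℝ) :
    (centredChar q θ).re = (1 - q) * Real.cos (q * θ) + q * Real.cos ((1 - q) * θ) := by
  rw [centredChar, Complex.add_re, Complex.re_ofReal_mul, Complex.re_ofReal_mul,
    Complex.exp_ofReal_mul_I_re, Complex.exp_ofReal_mul_I_re, Real.cos_neg]

theorem centredChar_im (q θ : ℝ) :
    (centredChar q θ).im = -((1 - q) * Real.sin (q * θ)) + q * Real.sin ((1 - q) * θ) := by
  rw [centredChar, Complex.add_im, Complex.im_ofReal_mul, Complex.im_ofReal_mul,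
    Complex.exp_ofReal_mul_I_im, Complex.exp_ofReal_mul_I_im, Real.sin_neg]
  ring

theorem continuous_centredChar (q : ℝ) : Continuous (centredChar q) := by
  unfold centredChar
  fun_prop

variable {q θ : ℝ}

theorem normSq_centredChar (q θ : ℝ) :
    ‖centredChar q θ‖ ^ 2 = 1 - 2 * (q * (1 - q)) * (1 - Real.cos θ) := by
  rw [Complex.sq_norm, Complex.normSq_apply, centredChar_re, centredChar_im]
  have h : Real.cos θ = Real.cos (q * θ) * Real.cos ((1 - q) * θ)
      - Real.sin (q * θ) * Real.sin ((1 - q) * θ) := by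
    rw [← Real.cos_add]; congr 1; ring
  rw [h]
  linear_combination (1 - q) ^ 2 * Real.cos_sq_add_sin_sq (q * θ)
    + q ^ 2 * Real.cos_sq_add_sin_sq ((1 - q) * θ)

/-- Follows from $1-\cos\theta\ge 2\theta^2/\pi^2$ and $1+x\le e^x$. The Gaussian decay holds on the
whole period, so no separate tail estimate is needed. -/
theorem norm_centredChar_le (h0 : 0 ≤ q) (h1 : q ≤ 1) (hθ : |θ| ≤ Real.pi) :
    ‖centredChar q θ‖ ≤ Real.exp (-(2 / Real.pi ^ 2 * (q * (1 - q)) * θ ^ 2)) := by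
  have hv : 0 ≤ q * (1 - q) := mul_nonneg h0 (by linarith)
  refine le_of_sq_le_sq ?_ (Real.exp_pos _).le
  rw [normSq_centredChar, ← Real.exp_nat_mul]
  have hc := Real.cos_le_one_sub_mul_cos_sq hθ
  refine le_trans ?_ (Real.add_one_le_exp _)
  push_cast
  nlinarith [mul_le_mul_of_nonneg_left hc hv]

/-- The two terms agree to second order, since $(1-q)q^2+q(1-q)^2=q(1-q)$. The factor $q(1-q)$ is
kept in the error so that the errors sum to a multiple of the variance. -/
theorem abs_re_centredChar_sub_le (h0 : 0 ≤ q) (h1 : q ≤ 1) :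
    |(centredChar q θ).re - Real.exp (-(q * (1 - q) * θ ^ 2 / 2))| ≤ 2 * (q * (1 - q)) * θ ^ 4 := by
  have h1' : 0 ≤ 1 - q := by linarith
  have hv : 0 ≤ q * (1 - q) := mul_nonneg h0 h1'
  have hv1 : q * (1 - q) ≤ 1 := by nlinarith
  rw [centredChar_re]
  have a1 := abs_le.1 (abs_cos_sub_quadratic_le (q * θ))
  have a2 := abs_le.1 (abs_cos_sub_quadratic_le ((1 - q) * θ))
  have a3 := abs_le.1 (abs_exp_neg_sub_linear_le (y := q * (1 - q) * θ ^ 2 / 2) (by positivity))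
  have b1 := mul_le_mul_of_nonneg_left a1.1 h1'
  have b2 := mul_le_mul_of_nonneg_left a1.2 h1'
  have b3 := mul_le_mul_of_nonneg_left a2.1 h0
  have b4 := mul_le_mul_of_nonneg_left a2.2 h0
  have c1 : (1 - q) * q ^ 4 + q * (1 - q) ^ 4 ≤ q * (1 - q) := by
    have e1 : q ^ 3 ≤ q := by
      simpa using pow_le_pow_of_le_one h0 h1 (show 1 ≤ 3 by norm_num)
    have e2 : (1 - q) ^ 3 ≤ 1 - q := by
      simpa using pow_le_pow_of_le_one h1' (by linarith) (show 1 ≤ 3 by norm_num)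
    nlinarith [mul_le_mul_of_nonneg_left e1 hv, mul_le_mul_of_nonneg_left e2 hv]
  have c2 := mul_le_mul_of_nonneg_right c1 (show 0 ≤ θ ^ 4 by positivity)
  have c3 : (q * (1 - q) * θ ^ 2 / 2) ^ 2 ≤ q * (1 - q) * θ ^ 4 := by
    have := mul_le_mul_of_nonneg_right (mul_le_mul_of_nonneg_left hv1 hv)
      (show 0 ≤ θ ^ 4 by positivity)
    nlinarith [show 0 ≤ (q * (1 - q)) ^ 2 * θ ^ 4 by positivity]
  rw [abs_le]
  constructor <;> nlinarith

/-- Centring cancels the linear terms of the two sines. -/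
theorem abs_im_centredChar_le (h0 : 0 ≤ q) (h1 : q ≤ 1) :
    |(centredChar q θ).im| ≤ q * (1 - q) * |θ| ^ 3 := by
  have h1' : 0 ≤ 1 - q := by linarith
  have hv : 0 ≤ q * (1 - q) := mul_nonneg h0 h1'
  rw [centredChar_im]
  have a1 := Real.abs_sub_sin_le (q * θ)
  have a2 := Real.abs_sub_sin_le ((1 - q) * θ)
  rw [abs_mul, abs_of_nonneg h0] at a1
  rw [abs_mul, abs_of_nonneg h1'] at a2
  have a1 := abs_le.1 a1
  have a2 := abs_le.1 a2
  have b1 := mul_le_mul_of_nonneg_left a1.1 h1'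
  have b2 := mul_le_mul_of_nonneg_left a1.2 h1'
  have b3 := mul_le_mul_of_nonneg_left a2.1 h0
  have b4 := mul_le_mul_of_nonneg_left a2.2 h0
  have c1 : (1 - q) * q ^ 3 + q * (1 - q) ^ 3 ≤ q * (1 - q) := by
    have e1 : q ^ 2 ≤ q := by nlinarith
    have e2 : (1 - q) ^ 2 ≤ 1 - q := by nlinarith
    nlinarith [mul_le_mul_of_nonneg_left e1 hv, mul_le_mul_of_nonneg_left e2 hv]
  have c2 := mul_le_mul_of_nonneg_right c1 (show 0 ≤ |θ| ^ 3 by positivity)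
  have c3 : 0 ≤ q * (1 - q) * |θ| ^ 3 := by positivity
  rw [abs_le]
  constructor <;> nlinarith

theorem norm_centredChar_sub_le (h0 : 0 ≤ q) (h1 : q ≤ 1) (hθ : |θ| ≤ Real.pi) :
    ‖centredChar q θ - (Real.exp (-(q * (1 - q) * θ ^ 2 / 2)) : ℝ)‖
      ≤ 9 * (q * (1 - q)) * |θ| ^ 3 := by
  have hv : 0 ≤ q * (1 - q) := mul_nonneg h0 (by linarith)
  refine (Complex.norm_le_abs_re_add_abs_im _).trans ?_
  rw [Complex.sub_re, Complex.sub_im, Complex.ofReal_re, Complex.ofReal_im, sub_zero]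
  have h4 : θ ^ 4 ≤ 4 * |θ| ^ 3 := by
    rw [show θ ^ 4 = |θ| * |θ| ^ 3 by
      rw [← pow_succ', ← abs_pow, abs_of_nonneg (Even.pow_nonneg ⟨2, rfl⟩ θ)]]
    gcongr
    exact hθ.trans Real.pi_le_four
  have := mul_le_mul_of_nonneg_left h4 hv
  linarith [abs_re_centredChar_sub_le (θ := θ) h0 h1, abs_im_centredChar_le (θ := θ) h0 h1]

/-! ### Comparison of products -/

/-- Second-order comparison of a product of complex numbers with a product of reals,
all in the unit disc. -/
theorem abs_re_prod_sub_prod_le {ι : Type*} (s : Finset ι) (f : ι → ℂ) (g D E : ι → ℝ)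
    (hf : ∀ i ∈ s, ‖f i‖ ≤ 1) (hg0 : ∀ i ∈ s, 0 ≤ g i) (hg : ∀ i ∈ s, g i ≤ 1)
    (hD : ∀ i ∈ s, ‖f i - g i‖ ≤ D i) (hE : ∀ i ∈ s, |(f i).re - g i| ≤ E i) :
    |(∏ i ∈ s, f i).re - ∏ i ∈ s, g i| ≤ ∑ i ∈ s, E i + (∑ i ∈ s, D i) ^ 2 := by
  classical
  -- The first-order norm bound is carried through the induction because it controls the cross term
  -- below.
  suffices h : ‖∏ i ∈ s, f i - (∏ i ∈ s, g i : ℝ)‖ ≤ ∑ i ∈ s, D i ∧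
      |(∏ i ∈ s, f i).re - ∏ i ∈ s, g i| ≤ ∑ i ∈ s, E i + (∑ i ∈ s, D i) ^ 2 from h.2
  induction s using Finset.induction_on with
  | empty => simp
  | insert j s hj ih =>
    have ih := ih (fun i hi => hf i (Finset.mem_insert_of_mem hi))
      (fun i hi => hg0 i (Finset.mem_insert_of_mem hi))
      (fun i hi => hg i (Finset.mem_insert_of_mem hi))
      (fun i hi => hD i (Finset.mem_insert_of_mem hi))
      (fun i hi => hE i (Finset.mem_insert_of_mem hi))
    have hfj := hf j (Finset.mem_insert_self _ _)
    have hg0j := hg0 j (Finset.mem_insert_self _ _)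
    have hgj := hg j (Finset.mem_insert_self _ _)
    have hDj := hD j (Finset.mem_insert_self _ _)
    have hEj := hE j (Finset.mem_insert_self _ _)
    have hG0 : 0 ≤ ∏ i ∈ s, g i :=
      Finset.prod_nonneg fun i hi => hg0 i (Finset.mem_insert_of_mem hi)
    have hG1 : ∏ i ∈ s, g i ≤ 1 :=
      Finset.prod_le_one (fun i hi => hg0 i (Finset.mem_insert_of_mem hi))
        fun i hi => hg i (Finset.mem_insert_of_mem hi)
    rw [Finset.prod_insert hj, Finset.prod_insert hj, Finset.sum_insert hj, Finset.sum_insert hj]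
    set F := ∏ i ∈ s, f i
    set G := ∏ i ∈ s, g i
    set SD := ∑ i ∈ s, D i
    set SE := ∑ i ∈ s, E i
    obtain ⟨ih1, ih2⟩ := ih
    have hSD : 0 ≤ SD := (norm_nonneg _).trans ih1
    have hDj0 : 0 ≤ D j := (norm_nonneg _).trans hDj
    constructor
    · have e : f j * F - ((g j * G : ℝ) : ℂ) = f j * (F - (G : ℝ)) + (f j - (g j : ℝ)) * (G : ℝ) := by
        push_cast; ring
      rw [e]
      refine (norm_add_le _ _).trans ?_
      rw [norm_mul, norm_mul, Complex.norm_real, Real.norm_of_nonneg hG0]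
      have u1 := mul_le_mul hfj ih1 (norm_nonneg _) zero_le_one
      have u2 := mul_le_mul hDj hG1 hG0 hDj0
      linarith
    -- Since `g j` and `G` are real, deviations in norm occur only multiplied together; their
    -- product `D j * SD` fits into `(D j + SD) ^ 2`.
    · have e : (f j * F).re - g j * G =
          ((f j - (g j : ℝ)) * (F - (G : ℝ))).re + g j * (F.re - G) + ((f j).re - g j) * G := by
        simp only [Complex.mul_re, Complex.sub_re, Complex.sub_im, Complex.ofReal_re,
          Complex.ofReal_im]
        ring
      rw [e]
      have u0 : |((f j - (g j : ℝ)) * (F - (G : ℝ))).re| ≤ D j * SD := by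
        refine (Complex.abs_re_le_norm _).trans ?_
        rw [norm_mul]
        exact mul_le_mul hDj ih1 (norm_nonneg _) hDj0
      have u1 : |g j * (F.re - G)| ≤ SE + SD ^ 2 := by
        rw [abs_mul, abs_of_nonneg hg0j]
        calc _ ≤ 1 * |F.re - G| := by gcongr
          _ ≤ _ := by rw [one_mul]; exact ih2
      have u2 : |((f j).re - g j) * G| ≤ E j := by
        rw [abs_mul, abs_of_nonneg hG0]
        calc _ ≤ |(f j).re - g j| * 1 := by gcongr
          _ ≤ _ := by rw [mul_one]; exact hEj
      refine (abs_add_three _ _ _).trans ?_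
      nlinarith [mul_nonneg hDj0 hSD, sq_nonneg (D j)]

/-! ### Fourier inversion -/

variable {n : ℕ}

/-- The probability of `a` under independent Bernoulli variables with parameters `q i`. -/
noncomputable def weight (q : Fin n → ℝ) (a : Fin n → Fin 2) : ℝ :=
  ∏ i, if a i = 1 then q i else 1 - q i

/-- The number of ones in `a`. -/
def total (a : Fin n → Fin 2) : ℕ := ∑ i, (a i : ℕ)

/-- The probability that independent Bernoulli variables with parameters `q i` sum to `m`. -/
noncomputable def sumProb (q : Fin n → ℝ) (m : ℕ) : ℝ :=
  ∑ a : Fin n → Fin 2, if total a = m then weight q a else 0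

/-- Because the mean is the integer `m`, the phases are integer frequencies, which are orthogonal on
$[-\pi,\pi]$. -/
theorem prod_centredChar (q : Fin n → ℝ) (m : ℕ) (hq : ∑ i, q i = m) (θ : ℝ) :
    ∏ i, centredChar (q i) θ = ∑ a : Fin n → Fin 2,
      (weight q a : ℂ) * Complex.exp ((((total a : ℤ) - (m : ℤ) : ℤ) * θ : ℝ) * Complex.I) := by
  have h : ∀ i, centredChar (q i) θ = ∑ b : Fin 2, ((if b = 1 then q i else 1 - q i : ℝ) : ℂ) *
      Complex.exp (((((b : ℕ) : ℝ) - q i) * θ : ℝ) * Complex.I) := by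
    intro i
    simp [Fin.sum_univ_two, centredChar]
  simp_rw [h]
  rw [Finset.prod_univ_sum, Fintype.piFinset_univ]
  refine Finset.sum_congr rfl fun a _ => ?_
  rw [Finset.prod_mul_distrib, ← Complex.exp_sum, ← Finset.sum_mul, weight]
  push_cast
  congr 3
  rw [← Finset.sum_mul]
  congr 1
  rw [Finset.sum_sub_distrib, total]
  push_cast
  congr 1
  exact_mod_cast hq

theorem integral_cos_int_mul (k : ℤ) :
    ∫ θ in -Real.pi..Real.pi, Real.cos (k * θ) = if k = 0 then 2 * Real.pi else 0 := by
  split_ifs with h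
  · simp [h]; ring
  · have hk : (k : ℝ) ≠ 0 := by exact_mod_cast h
    rw [intervalIntegral.integral_comp_mul_left (fun x => Real.cos x) hk, integral_cos]
    simp [Real.sin_int_mul_pi]

/-- Fourier inversion for the law of a sum of independent Bernoulli variables. -/
theorem integral_re_prod_centredChar (q : Fin n → ℝ) (m : ℕ) (hq : ∑ i, q i = m) :
    ∫ θ in -Real.pi..Real.pi, (∏ i, centredChar (q i) θ).re = 2 * Real.pi * sumProb q m := by
  have h : ∀ θ : ℝ, (∏ i, centredChar (q i) θ).re = ∑ a : Fin n → Fin 2,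
      weight q a * Real.cos (((total a : ℤ) - (m : ℤ) : ℤ) * θ) := by
    intro θ
    rw [prod_centredChar q m hq, Complex.re_sum]
    refine Finset.sum_congr rfl fun a _ => ?_
    rw [Complex.re_ofReal_mul, Complex.exp_ofReal_mul_I_re]
  simp_rw [h]
  rw [intervalIntegral.integral_finsetSum]
  · rw [sumProb, Finset.mul_sum]
    refine Finset.sum_congr rfl fun a _ => ?_
    rw [intervalIntegral.integral_const_mul, integral_cos_int_mul]
    have : ((total a : ℤ) - (m : ℤ) = 0) ↔ total a = m := by omega
    simp only [this]
    split_ifs <;> ring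
  · intro a _
    apply Continuous.intervalIntegrable
    fun_prop

/-! ### Gaussian comparison and the local limit theorem -/

/-- Half of the exponential decay absorbs the power; the constant is $2!\cdot 10^2$. -/
theorem sq_mul_exp_neg_le {y : ℝ} (hy : 0 ≤ y) :
    y ^ 2 * Real.exp (-(y / 5)) ≤ 200 * Real.exp (-(y / 10)) := by
  have h := Real.pow_div_factorial_le_exp (y / 10) (by positivity) 2
  have e : Real.exp (-(y / 5)) = Real.exp (-(y / 10)) * Real.exp (-(y / 10)) := by
    rw [← Real.exp_add]; congr 1; ring
  have h' : y ^ 2 ≤ 200 * Real.exp (y / 10) := by norm_num [Nat.factorial] at h; nlinarith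
  calc _ ≤ 200 * Real.exp (y / 10) * Real.exp (-(y / 5)) := by gcongr
    _ = _ := by rw [mul_assoc, ← Real.exp_add]; congr 2; ring

theorem cube_mul_exp_neg_le {y : ℝ} (hy : 0 ≤ y) :
    y ^ 3 * Real.exp (-(y / 5)) ≤ 6000 * Real.exp (-(y / 10)) := by
  have h := Real.pow_div_factorial_le_exp (y / 10) (by positivity) 3
  have h' : y ^ 3 ≤ 6000 * Real.exp (y / 10) := by norm_num [Nat.factorial] at h; nlinarith
  calc _ ≤ 6000 * Real.exp (y / 10) * Real.exp (-(y / 5)) := by gcongr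
    _ = _ := by rw [mul_assoc, ← Real.exp_add]; congr 2; ring

theorem two_div_pi_sq_ge : 1 / 5 ≤ 2 / Real.pi ^ 2 := by
  have h : Real.pi ^ 2 ≤ 10 := by nlinarith [Real.pi_lt_d2, Real.pi_pos]
  rw [div_le_div_iff₀ (by norm_num) (by positivity)]
  linarith

theorem abs_re_prod_centredChar_sub_le (q : Fin n → ℝ) (h0 : ∀ i, 0 ≤ q i) (h1 : ∀ i, q i ≤ 1)
    {s θ : ℝ} (hs : ∑ i, q i * (1 - q i) = s) (hθ : |θ| ≤ Real.pi) :
    |(∏ i, centredChar (q i) θ).re - Real.exp (-(s * θ ^ 2 / 2))| ≤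
      (4 * s * θ ^ 4 + 324 * s ^ 2 * θ ^ 6) * Real.exp (-(s * θ ^ 2 / 5)) := by
  have hv : ∀ i, 0 ≤ q i * (1 - q i) := fun i => mul_nonneg (h0 i) (by linarith [h1 i])
  have hs0 : 0 ≤ s := hs ▸ Finset.sum_nonneg fun i _ => hv i
  have hpi := two_div_pi_sq_ge
  have hpi2 : 2 / Real.pi ^ 2 * θ ^ 2 ≤ 2 := by
    rw [div_mul_eq_mul_div, div_le_iff₀ (by positivity), ← sq_abs θ]
    gcongr
  set c := 2 / Real.pi ^ 2
  set r : Fin n → ℝ := fun i => Real.exp (-(c * (q i * (1 - q i)) * θ ^ 2)) with hr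
  set g : Fin n → ℝ := fun i => Real.exp (-(q i * (1 - q i) * θ ^ 2 / 2)) with hg
  have hr0 : ∀ i, 0 < r i := fun i => Real.exp_pos _
  have hrinv : ∀ i, (r i)⁻¹ ≤ 2 := by
    intro i
    rw [hr, ← Real.exp_neg, neg_neg]
    have hv4 : q i * (1 - q i) ≤ 1 / 4 := by nlinarith [sq_nonneg (q i - 1 / 2)]
    have hh : c * (q i * (1 - q i)) * θ ^ 2 ≤ 1 / 2 := by nlinarith [hv i]
    have hsq : Real.exp (1 / 2) ^ 2 ≤ 2 ^ 2 := by
      rw [← Real.exp_nat_mul]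
      norm_num
      linarith [Real.exp_one_lt_d9]
    exact (Real.exp_le_exp.2 hh).trans (le_of_sq_le_sq hsq (by norm_num))
  have hgr : ∀ i, g i ≤ r i := by
    intro i
    refine Real.exp_le_exp.2 ?_
    have hc : c ≤ 1 / 2 := by
      have : (4 : ℝ) ≤ Real.pi ^ 2 := by nlinarith [Real.pi_gt_three]
      rw [div_le_div_iff₀ (by positivity) (by norm_num)]
      linarith
    nlinarith [mul_le_mul_of_nonneg_right hc (mul_nonneg (hv i) (sq_nonneg θ))]
  -- Dividing by the modulus bounds `r i` puts all factors in the unit disc while saving the decay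
  -- $\prod_i r_i$, which is multiplied back afterwards. Each division costs a factor of at most 2.
  have key := abs_re_prod_sub_prod_le Finset.univ (fun i => centredChar (q i) θ / (r i : ℂ))
    (fun i => g i / r i) (fun i => 18 * |θ| ^ 3 * (q i * (1 - q i)))
    (fun i => 4 * θ ^ 4 * (q i * (1 - q i)))
    (fun i _ => by
      rw [norm_div, Complex.norm_real, Real.norm_of_nonneg (hr0 i).le, div_le_one (hr0 i)]
      exact norm_centredChar_le (h0 i) (h1 i) hθ)
    (fun i _ => div_nonneg (Real.exp_pos _).le (hr0 i).le)
    (fun i _ => (div_le_one (hr0 i)).2 (hgr i))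
    (fun i _ => by
      rw [Complex.ofReal_div, ← sub_div, norm_div, Complex.norm_real,
        Real.norm_of_nonneg (hr0 i).le, div_eq_mul_inv]
      calc _ ≤ 9 * (q i * (1 - q i)) * |θ| ^ 3 * 2 :=
            mul_le_mul (norm_centredChar_sub_le (h0 i) (h1 i) hθ) (hrinv i)
              (inv_nonneg.2 (hr0 i).le)
              (mul_nonneg (mul_nonneg (by norm_num) (hv i)) (by positivity))
        _ = _ := by ring)
    (fun i _ => by
      rw [Complex.div_ofReal_re, ← sub_div, abs_div, abs_of_pos (hr0 i), div_eq_mul_inv]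
      calc _ ≤ 2 * (q i * (1 - q i)) * θ ^ 4 * 2 :=
            mul_le_mul (abs_re_centredChar_sub_le (h0 i) (h1 i)) (hrinv i)
              (inv_nonneg.2 (hr0 i).le)
              (mul_nonneg (mul_nonneg (by norm_num) (hv i)) (by positivity))
        _ = _ := by ring)
  have hR : ∏ i, r i = Real.exp (-(c * s * θ ^ 2)) := by
    rw [hr, ← Real.exp_sum, Finset.sum_neg_distrib, ← Finset.sum_mul, ← Finset.mul_sum, hs]
  have hG : ∏ i, g i = Real.exp (-(s * θ ^ 2 / 2)) := by
    rw [hg, ← Real.exp_sum, Finset.sum_neg_distrib, ← Finset.sum_div, ← Finset.sum_mul, hs]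
  rw [Finset.prod_div_distrib, Finset.prod_div_distrib, ← Complex.ofReal_prod,
    Complex.div_ofReal_re, ← sub_div, hR, hG, abs_div, abs_of_pos (Real.exp_pos _),
    div_le_iff₀ (Real.exp_pos _), ← Finset.mul_sum, ← Finset.mul_sum, hs] at key
  refine key.trans ?_
  have e6 : (|θ| ^ 3) ^ 2 = θ ^ 6 := by
    rw [← pow_mul, ← abs_pow, abs_of_nonneg (Even.pow_nonneg ⟨3, rfl⟩ θ)]
  have e : 4 * θ ^ 4 * s + (18 * |θ| ^ 3 * s) ^ 2 = 4 * s * θ ^ 4 + 324 * s ^ 2 * θ ^ 6 := by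
    rw [mul_pow, mul_pow, e6]; ring
  rw [e]
  gcongr
  nlinarith [mul_le_mul_of_nonneg_right hpi (mul_nonneg hs0 (sq_nonneg θ))]

theorem poly_mul_exp_le {s : ℝ} (hs : 0 < s) (θ : ℝ) :
    (4 * s * θ ^ 4 + 324 * s ^ 2 * θ ^ 6) * Real.exp (-(s * θ ^ 2 / 5)) ≤
      2000000 / s * Real.exp (-(s / 10) * θ ^ 2) := by
  have hy : 0 ≤ s * θ ^ 2 := by positivity
  have h2 := sq_mul_exp_neg_le hy
  have h3 := cube_mul_exp_neg_le hy
  rw [show -(s / 10) * θ ^ 2 = -(s * θ ^ 2 / 10) by ring]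
  set A := Real.exp (-(s * θ ^ 2 / 5))
  have hB : 0 < Real.exp (-(s * θ ^ 2 / 10)) := Real.exp_pos _
  set B := Real.exp (-(s * θ ^ 2 / 10))
  -- With $y=s\theta^2$ the polynomial times $s$ is $4y^2+324y^3$, and $4\cdot 200+324\cdot 6000\le
  -- 2000000$.
  rw [div_mul_eq_mul_div, le_div_iff₀ hs]
  nlinarith

/-- Local limit theorem for sums of independent Bernoulli variables, at the mean. -/
theorem abs_sqrt_mul_sumProb_sub_one_le (q : Fin n → ℝ) (h0 : ∀ i, 0 ≤ q i) (h1 : ∀ i, q i ≤ 1)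
    {m : ℕ} (hq : ∑ i, q i = m) {s : ℝ} (hs : ∑ i, q i * (1 - q i) = s) (hs1 : 1 ≤ s) :
    |Real.sqrt (2 * Real.pi * s) * sumProb q m - 1| ≤ 6000000 / s := by
  have hs0 : 0 < s := by linarith
  set I := Set.Ioc (-Real.pi) Real.pi
  set F : ℝ → ℝ := fun θ => (∏ i, centredChar (q i) θ).re
  have hFc : Continuous F :=
    Complex.continuous_re.comp (continuous_finsetProd _ fun i _ => continuous_centredChar (q i))
  have hFi : Integrable (I.indicator F) := by
    rw [integrable_indicator_iff measurableSet_Ioc]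
    exact (hFc.intervalIntegrable _ _).1
  have hFint : ∫ θ, I.indicator F θ = 2 * Real.pi * sumProb q m := by
    rw [integral_indicator measurableSet_Ioc, ← integral_re_prod_centredChar q m hq,
      intervalIntegral.integral_of_le (by linarith [Real.pi_pos])]
  have hGi : Integrable fun θ : ℝ => Real.exp (-(s / 2) * θ ^ 2) :=
    integrable_exp_neg_mul_sq (by positivity)
  have hBi : Integrable fun θ : ℝ => 2000000 / s * Real.exp (-(s / 10) * θ ^ 2) :=
    (integrable_exp_neg_mul_sq (by positivity)).const_mul _
  have hpt : ∀ θ, ‖I.indicator F θ - Real.exp (-(s / 2) * θ ^ 2)‖ ≤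
      2000000 / s * Real.exp (-(s / 10) * θ ^ 2) := by
    intro θ
    refine le_trans ?_ (poly_mul_exp_le hs0 θ)
    rw [Real.norm_eq_abs, show -(s / 2) * θ ^ 2 = -(s * θ ^ 2 / 2) by ring]
    by_cases hθ : θ ∈ I
    · rw [Set.indicator_of_mem hθ]
      exact abs_re_prod_centredChar_sub_le q h0 h1 hs (abs_le.2 ⟨hθ.1.le, hθ.2⟩)
    -- Off the period only the Gaussian remains; there $\theta^2\ge 1$ and $s\ge 1$ make the
    -- polynomial at least 1, so the same bound holds.
    · rw [Set.indicator_of_notMem hθ, zero_sub, abs_neg, abs_of_pos (Real.exp_pos _)]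
      have hθ1 : 1 ≤ θ ^ 2 := by
        have : Real.pi ≤ |θ| := by
          by_contra hlt
          rw [not_le, abs_lt] at hlt
          exact hθ ⟨hlt.1, hlt.2.le⟩
        rw [← sq_abs]
        nlinarith [Real.pi_gt_three]
      have hp : 1 ≤ 4 * s * θ ^ 4 + 324 * s ^ 2 * θ ^ 6 := by
        have : 1 ≤ θ ^ 4 := by nlinarith
        have h6 : 0 ≤ 324 * s ^ 2 * θ ^ 6 := by positivity
        nlinarith
      calc Real.exp (-(s * θ ^ 2 / 2)) ≤ 1 * Real.exp (-(s * θ ^ 2 / 5)) := by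
            rw [one_mul]
            exact Real.exp_le_exp.2 (by nlinarith)
        _ ≤ _ := by gcongr
  have hint := norm_integral_le_of_norm_le hBi (Filter.Eventually.of_forall hpt)
  rw [integral_sub hFi hGi, hFint, integral_gaussian, integral_const_mul, integral_gaussian,
    Real.norm_eq_abs] at hint
  have e1 : Real.sqrt (Real.pi / (s / 10)) = Real.sqrt 5 * Real.sqrt (Real.pi / (s / 2)) := by
    rw [← Real.sqrt_mul (by norm_num)]
    congr 1
    field_simp
    norm_num
  have e2 : Real.sqrt (2 * Real.pi * s) * Real.sqrt (Real.pi / (s / 2)) = 2 * Real.pi := by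
    rw [← Real.sqrt_mul (by positivity),
      show 2 * Real.pi * s * (Real.pi / (s / 2)) = (2 * Real.pi) ^ 2 by field_simp]
    exact Real.sqrt_sq (by positivity)
  have hw : 0 < Real.sqrt (Real.pi / (s / 2)) := Real.sqrt_pos.2 (by positivity)
  rw [e1] at hint
  set w := Real.sqrt (Real.pi / (s / 2))
  have h5 : Real.sqrt 5 ≤ 3 := by
    rw [Real.sqrt_le_left (by norm_num)]; norm_num
  -- Here $w=\sqrt{2\pi/s}$ is the main term; factoring it out turns the absolute error into a
  -- relative one.
  have e3 : 2 * Real.pi * sumProb q m - w = w * (Real.sqrt (2 * Real.pi * s) * sumProb q m - 1) := by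
    linear_combination (-sumProb q m) * e2
  rw [e3, abs_mul, abs_of_pos hw] at hint
  refine le_of_mul_le_mul_left (hint.trans ?_) hw
  calc 2000000 / s * (Real.sqrt 5 * w) ≤ 2000000 / s * (3 * w) := by gcongr
    _ = _ := by ring

/-! ### Exponential tilting -/

/-- The moment generating function of a Bernoulli variable with parameter `p`. -/
noncomputable def bernoulliMgf (p t : ℝ) : ℝ := 1 - p + p * Real.exp t

/-- The parameter of the exponentially tilted Bernoulli variable. -/
noncomputable def tilt (p t : ℝ) : ℝ := p * Real.exp t / bernoulliMgf p t

theorem bernoulliMgf_pos (p : unitInterval) (t : ℝ) : 0 < bernoulliMgf p t := by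
  have h0 := p.2.1
  have h1 := p.2.2
  unfold bernoulliMgf
  rcases h0.eq_or_lt with h | h
  · rw [← h]; norm_num
  · have := mul_pos h (Real.exp_pos t)
    linarith

theorem one_sub_tilt (p : unitInterval) (t : ℝ) :
    1 - tilt p t = (1 - p) / bernoulliMgf p t := by
  have h := (bernoulliMgf_pos p t).ne'
  rw [tilt, eq_div_iff h, sub_mul, div_mul_cancel₀ _ h, bernoulliMgf]
  ring

theorem tilt_nonneg (p : unitInterval) (t : ℝ) : 0 ≤ tilt p t :=
  div_nonneg (mul_nonneg p.2.1 (Real.exp_pos t).le) (bernoulliMgf_pos p t).le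

theorem tilt_le_one (p : unitInterval) (t : ℝ) : tilt p t ≤ 1 := by
  have : 0 ≤ 1 - tilt p t := by
    rw [one_sub_tilt]
    exact div_nonneg (sub_nonneg.2 p.2.2) (bernoulliMgf_pos p t).le
  linarith

theorem hasDerivAt_bernoulliMgf (p t : ℝ) :
    HasDerivAt (bernoulliMgf p) (p * Real.exp t) t :=
  ((Real.hasDerivAt_exp t).const_mul p).const_add (1 - p)

/-- The tilted parameter solves the logistic equation, which makes $\psi''$ the variance of the
tilted sum. -/
theorem hasDerivAt_tilt (p : unitInterval) (t : ℝ) :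
    HasDerivAt (tilt p) (tilt p t * (1 - tilt p t)) t := by
  have h := (bernoulliMgf_pos p t).ne'
  refine (((Real.hasDerivAt_exp t).const_mul (p : ℝ)).div (hasDerivAt_bernoulliMgf p t)
    h).congr_deriv ?_
  rw [one_sub_tilt, tilt]
  field_simp
  rw [bernoulliMgf]
  ring

theorem deriv_cumulantGen (p : Fin n → unitInterval) :
    deriv (cumulantGen p) = fun t => ∑ i, tilt (p i) t := by
  funext t
  have : HasDerivAt (cumulantGen p) (∑ i, tilt (p i) t) t :=
    HasDerivAt.fun_sum fun i _ =>
      (hasDerivAt_bernoulliMgf (p i) t).log (bernoulliMgf_pos (p i) t).ne'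
  exact this.deriv

theorem hasDerivAt_sum_tilt (p : Fin n → unitInterval) (t : ℝ) :
    HasDerivAt (fun t => ∑ i, tilt (p i) t) (∑ i, tilt (p i) t * (1 - tilt (p i) t)) t :=
  HasDerivAt.fun_sum fun i _ => hasDerivAt_tilt (p i) t

theorem deriv_deriv_cumulantGen (p : Fin n → unitInterval) (t : ℝ) :
    deriv (deriv (cumulantGen p)) t = ∑ i, tilt (p i) t * (1 - tilt (p i) t) := by
  rw [deriv_cumulantGen]
  exact (hasDerivAt_sum_tilt p t).deriv

theorem exp_cumulantGen (p : Fin n → unitInterval) (t : ℝ) :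
    Real.exp (cumulantGen p t) = ∏ i, bernoulliMgf (p i) t := by
  rw [cumulantGen, Real.exp_sum]
  exact Finset.prod_congr rfl fun i _ => Real.exp_log (bernoulliMgf_pos (p i) t)

/-- The change-of-measure density depends on `a` only through `total a`, so it is constant on the
budget event. -/
theorem weight_eq_tilt (p : Fin n → unitInterval) (t : ℝ) (a : Fin n → Fin 2) :
    weight (fun i => (p i : ℝ)) a = weight (fun i => tilt (p i) t) a *
      Real.exp (cumulantGen p t - total a * t) := by
  rw [Real.exp_sub, exp_cumulantGen, total]
  push_cast
  rw [Finset.sum_mul, Real.exp_sum, ← Finset.prod_div_distrib, weight, weight,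
    ← Finset.prod_mul_distrib]
  refine Finset.prod_congr rfl fun i _ => ?_
  have h := (bernoulliMgf_pos (p i) t).ne'
  have he := (Real.exp_pos t).ne'
  rcases (show a i = 0 ∨ a i = 1 by omega) with h0 | h0
  · simp only [h0, one_sub_tilt]
    simp [h]
  · simp only [h0, tilt]
    simp
    field_simp

theorem sumProb_eq_tilt (p : Fin n → unitInterval) (t : ℝ) (m : ℕ) :
    sumProb (fun i => (p i : ℝ)) m = sumProb (fun i => tilt (p i) t) m *
      Real.exp (cumulantGen p t - m * t) := by
  rw [sumProb, sumProb, Finset.sum_mul]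
  refine Finset.sum_congr rfl fun a _ => ?_
  split_ifs with h
  · rw [weight_eq_tilt p t, h]
  · rw [zero_mul]

/-! ### Relative error of the constrained probability -/

instance (p : Fin n → unitInterval) : IsProbabilityMeasure (policy p) := by
  unfold policy; infer_instance

theorem policy_real_singleton (p : Fin n → unitInterval) (a : Fin n → Fin 2) :
    (policy p).real {a} = weight (fun i => (p i : ℝ)) a := by
  rw [policy, measureReal_def, Measure.pi_singleton, ENNReal.toReal_prod, weight]
  refine Finset.prod_congr rfl fun i _ => ?_
  rw [← measureReal_def]
  rcases (show a i = 0 ∨ a i = 1 by omega) with h0 | h0 <;> simp [h0]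

theorem mem_budget {k : ℝ} {m : ℕ} (hm : (m : ℝ) = k * n) (a : Fin n → Fin 2) :
    a ∈ budget n k ↔ total a = m := by
  rw [budget, Set.mem_ofPred_eq, ← hm, total, ← Nat.cast_sum, Nat.cast_inj]

theorem policy_real_budget (p : Fin n → unitInterval) {k : ℝ} {m : ℕ} (hm : (m : ℝ) = k * n) :
    (policy p).real (budget n k) = sumProb (fun i => (p i : ℝ)) m := by
  have h : budget n k = ((Finset.univ.filter fun a : Fin n → Fin 2 => total a = m : Finset _) :
      Set (Fin n → Fin 2)) := by
    ext a
    simp [mem_budget hm]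
  rw [h, ← sum_measureReal_singleton, Finset.sum_filter, sumProb]
  simp_rw [policy_real_singleton]

/-- Relative error of the saddle point approximation in terms of `ψ''` at the saddle point. -/
theorem exists_relative_error (p : Fin n → unitInterval) {k t s : ℝ} {m : ℕ}
    (hm : (m : ℝ) = k * n) (ht : IsSaddlePoint p k t)
    (hs : deriv (deriv (cumulantGen p)) t = s) (hs1 : 12000000 ≤ s) (a : Fin n → Fin 2) :
    ∃ ε : ℝ, |ε| ≤ 12000000 / s ∧
      constrainedProb p k a = approxConstrainedProb p k t a * (1 - ε) := by
  have hq : ∑ i, tilt (p i) t = m := by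
    rw [hm, ← show _ = k * n from ht, deriv_cumulantGen]
  have hs0 : 0 < s := by linarith
  have hr := abs_sqrt_mul_sumProb_sub_one_le (fun i => tilt (p i) t)
    (fun i => tilt_nonneg (p i) t) (fun i => tilt_le_one (p i) t) hq
    ((deriv_deriv_cumulantGen p t).symm.trans hs) (by linarith)
  have hP : (policy p).real (budget n k) =
      saddleNormaliser p k t *
        (Real.sqrt (2 * Real.pi * s) * sumProb (fun i => tilt (p i) t) m) := by
    rw [policy_real_budget p hm, sumProb_eq_tilt p t, saddleNormaliser, hs, ← hm]
    have : Real.sqrt (2 * Real.pi * s) ≠ 0 := (Real.sqrt_pos.2 (by positivity)).ne'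
    field_simp
  set r := Real.sqrt (2 * Real.pi * s) * sumProb (fun i => tilt (p i) t) m
  have hhalf : 6000000 / s ≤ 1 / 2 := by
    rw [div_le_div_iff₀ hs0 (by norm_num)]; linarith
  have hr2 : 1 / 2 ≤ r := by linarith [(abs_le.1 hr).1]
  have hr0 : 0 < r := by linarith
  -- The exact normaliser is `r` times the approximate one, so $1-\varepsilon=1/r$. The bound $r\ge
  -- 1/2$ doubles the constant.
  refine ⟨1 - 1 / r, ?_, ?_⟩
  · rw [show 1 - 1 / r = (r - 1) / r by field_simp, abs_div, abs_of_pos hr0, div_le_iff₀ hr0]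
    calc |r - 1| ≤ 6000000 / s := hr
      _ = 12000000 / s * (1 / 2) := by ring
      _ ≤ 12000000 / s * r := by gcongr
  · rw [constrainedProb, measureReal_def, cond_apply (Set.toFinite _).measurableSet, ENNReal.toReal_mul,
      ENNReal.toReal_inv, ← measureReal_def, ← measureReal_def, hP,
      approxConstrainedProb, sub_sub_cancel]
    by_cases ha : a ∈ budget n k
    · rw [Set.indicator_of_mem ha, Set.inter_eq_self_of_subset_right (by simpa using ha),
        mul_inv]
      ring
    · rw [Set.indicator_of_notMem ha, Set.inter_singleton_eq_empty.2 ha]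
      simp

theorem exists_relative_error_of_mul_le {δ : ℝ} (hδ : 0 < δ) (hn : 12000000 / δ ≤ n)
    (p : Fin n → unitInterval) {k t : ℝ} (hm : ∃ m : ℕ, (m : ℝ) = k * n)
    (ht : IsSaddlePoint p k t) (hs : δ * n ≤ deriv (deriv (cumulantGen p)) t)
    (a : Fin n → Fin 2) :
    ∃ ε : ℝ, |ε| ≤ 12000000 / δ / n ∧
      constrainedProb p k a = approxConstrainedProb p k t a * (1 - ε) := by
  obtain ⟨m, hm⟩ := hm
  have hn' : 12000000 ≤ δ * n := by
    rw [div_le_iff₀ hδ] at hn; linarith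
  obtain ⟨ε, h1, h2⟩ := exists_relative_error p hm ht rfl (hn'.trans hs) a
  refine ⟨ε, h1.trans ?_, h2⟩
  rw [div_div]
  exact div_le_div_of_nonneg_left (by norm_num) (by linarith) hs

/-! ### Existence, uniqueness and location of the saddle point -/

/-- At the upper end of the search interval every tilted parameter is at least `1 - δ`. -/
theorem one_sub_le_tilt {δ R : ℝ} (hδ : 0 < δ) (hR : R * δ = 1 - δ)
    {p : unitInterval} (h0 : δ ≤ (p : ℝ)) (h1 : (p : ℝ) ≤ 1 - δ) {t : ℝ}
    (ht : R ^ 2 ≤ Real.exp t) : 1 - δ ≤ tilt p t := by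
  -- Tilting multiplies the odds by $e^t$. The odds of `p` are at least $1/R$, so the factor $R^2$
  -- raises them to at least $R$, the odds of $1-\delta$.
  rw [tilt, le_div_iff₀ (bernoulliMgf_pos p t), bernoulliMgf]
  have h2 : (1 - δ) ^ 2 ≤ δ ^ 2 * Real.exp t := by
    rw [← hR, mul_pow, mul_comm]; gcongr
  have h3 : δ * (δ * Real.exp t) ≤ δ * (p * Real.exp t) := by gcongr
  nlinarith

/-- At the lower end of the search interval every tilted parameter is at most `δ`. -/
theorem tilt_le_of_exp_le {δ R : ℝ} (hδ : 0 < δ) (hR : R * δ = 1 - δ)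
    {p : unitInterval} (h0 : δ ≤ (p : ℝ)) (h1 : (p : ℝ) ≤ 1 - δ) {t : ℝ}
    (ht : R ^ 2 * Real.exp t ≤ 1) : tilt p t ≤ δ := by
  rw [tilt, div_le_iff₀ (bernoulliMgf_pos p t), bernoulliMgf]
  have h2 : (1 - δ) ^ 2 * Real.exp t ≤ δ ^ 2 := by
    rw [← hR, mul_pow]
    nlinarith [sq_nonneg δ]
  have h4 : 0 ≤ 1 - δ := by linarith
  have h3 : (1 - δ) * Real.exp t * p ≤ (1 - δ) * Real.exp t * (1 - δ) := by
    gcongr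
  nlinarith

/-- With parameters and proportion bounded away from `0` and `1` there is a unique saddle point,
and `ψ''` is of order `n` there. -/
theorem existsUnique_isSaddlePoint {δ R : ℝ} (hδ : 0 < δ) (hδ2 : δ ≤ 1 / 2)
    (hR : R * δ = 1 - δ) (hn : 0 < n) (p : Fin n → unitInterval)
    (hp : ∀ i, δ ≤ (p i : ℝ) ∧ (p i : ℝ) ≤ 1 - δ) {k : ℝ} (hk0 : δ ≤ k) (hk1 : k ≤ 1 - δ) :
    (∃! t : ℝ, IsSaddlePoint p k t) ∧
      ∀ t, IsSaddlePoint p k t → δ ^ 2 / R ^ 6 * n ≤ deriv (deriv (cumulantGen p)) t := by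
  have hR1 : 1 ≤ R := by nlinarith
  have hR0 : 0 < R := by linarith
  have : Nonempty (Fin n) := ⟨⟨0, hn⟩⟩
  have hmono : StrictMono fun t => ∑ i, tilt (p i) t := by
    refine strictMono_of_hasDerivAt_pos (hasDerivAt_sum_tilt p) fun t => ?_
    refine Finset.sum_pos (fun i _ => ?_) Finset.univ_nonempty
    rw [one_sub_tilt, tilt]
    have h1 : 0 < (p i : ℝ) := by linarith [(hp i).1]
    have h2 : 0 < 1 - (p i : ℝ) := by linarith [(hp i).2]
    have h3 := bernoulliMgf_pos (p i) t
    positivity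
  have hcont : Continuous fun t => ∑ i, tilt (p i) t :=
    continuous_iff_continuousAt.2 fun t => (hasDerivAt_sum_tilt p t).continuousAt
  set T := Real.log (R ^ 2)
  have hT : Real.exp T = R ^ 2 := Real.exp_log (by positivity)
  have hT0 : 0 ≤ T := Real.log_nonneg (by nlinarith)
  have hup : k * n ≤ ∑ i, tilt (p i) T := by
    calc k * n ≤ ∑ _i : Fin n, (1 - δ) := by
          rw [Finset.sum_const, Finset.card_univ, Fintype.card_fin, nsmul_eq_mul, mul_comm]
          gcongr
      _ ≤ _ := Finset.sum_le_sum fun i _ => one_sub_le_tilt hδ hR (hp i).1 (hp i).2 hT.ge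
  have hlow : ∑ i, tilt (p i) (-T) ≤ k * n := by
    calc _ ≤ ∑ _i : Fin n, δ := Finset.sum_le_sum fun i _ =>
          tilt_le_of_exp_le hδ hR (hp i).1 (hp i).2
            (by rw [Real.exp_neg, hT, mul_inv_cancel₀ (by positivity)])
      _ ≤ _ := by
          rw [Finset.sum_const, Finset.card_univ, Fintype.card_fin, nsmul_eq_mul, mul_comm]
          gcongr
  have hiff : ∀ t, IsSaddlePoint p k t ↔ ∑ i, tilt (p i) t = k * n := by
    intro t
    rw [IsSaddlePoint, deriv_cumulantGen]
  constructor
  · obtain ⟨t, -, ht⟩ := intermediate_value_Icc (show -T ≤ T by linarith) hcont.continuousOn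
      ⟨hlow, hup⟩
    exact ⟨t, (hiff t).2 ht, fun u hu => hmono.injective (((hiff u).1 hu).trans ht.symm)⟩
  · intro t ht
    rw [hiff] at ht
    have htu : t ≤ T := hmono.le_iff_le.1 (ht.le.trans hup)
    have htl : -T ≤ t := hmono.le_iff_le.1 (hlow.trans ht.ge)
    have heu : Real.exp t ≤ R ^ 2 := hT ▸ Real.exp_le_exp.2 htu
    have hel : (R ^ 2)⁻¹ ≤ Real.exp t := by
      rw [← hT, ← Real.exp_neg]; exact Real.exp_le_exp.2 htl
    rw [deriv_deriv_cumulantGen]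
    calc δ ^ 2 / R ^ 6 * n = ∑ _i : Fin n, δ ^ 2 / R ^ 6 := by
          rw [Finset.sum_const, Finset.card_univ, Fintype.card_fin, nsmul_eq_mul, mul_comm]
      _ ≤ _ := Finset.sum_le_sum fun i _ => ?_
    obtain ⟨h0, h1⟩ := hp i
    have hM := bernoulliMgf_pos (p i) t
    -- A convex combination of $1$ and $e^t$, both at most $R^2$. In the variance the numerator is
    -- at least $\delta^2R^{-2}$ and the denominator at most $R^4$, whence $\delta^2/R^6$.
    have hM1 : bernoulliMgf (p i) t ≤ R ^ 2 := by
      rw [bernoulliMgf]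
      nlinarith
    rw [one_sub_tilt, tilt, div_mul_div_comm]
    calc δ ^ 2 / R ^ 6 = δ * (R ^ 2)⁻¹ * δ / (R ^ 2 * R ^ 2) := by field_simp
      _ ≤ _ := by
        have : 0 ≤ 1 - (p i : ℝ) := by linarith
        have h2 : 0 ≤ p i * Real.exp t := mul_nonneg (p i).2.1 (Real.exp_pos t).le
        have h3 : 0 ≤ p i * Real.exp t * (1 - (p i : ℝ)) := mul_nonneg h2 this
        gcongr
        · linarith
        · linarith

end SaddlePoint

/-! ### Choice of constants -/

open SaddlePoint in
theorem proposition2 (δ : ℝ) (hδ : 0 < δ) :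
    ∃ (C : ℝ) (N : ℕ), ∀ n : ℕ, N ≤ n → ∀ (p : Fin n → unitInterval) (k : ℝ),
      (∃ m : ℕ, (m : ℝ) = k * n) →
      -- parameters and proportion bounded away from `0` and `1`
      ((∀ i, δ ≤ (p i : ℝ) ∧ (p i : ℝ) ≤ 1 - δ) → δ ≤ k → k ≤ 1 - δ →
        (∃! t : ℝ, IsSaddlePoint p k t) ∧
        ∀ t : ℝ, IsSaddlePoint p k t → ∀ a : Fin n → Fin 2,
          ∃ ε : ℝ, |ε| ≤ C / n ∧
            constrainedProb p k a = approxConstrainedProb p k t a * (1 - ε)) ∧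
      -- arbitrary parameters in `[0,1]`, with `ψ''` of order `n` at the saddle point
      (∀ t : ℝ, IsSaddlePoint p k t → δ * n ≤ deriv (deriv (cumulantGen p)) t →
        ∀ a : Fin n → Fin 2,
          ∃ ε : ℝ, |ε| ≤ C / n ∧
            constrainedProb p k a = approxConstrainedProb p k t a * (1 - ε)) := by
  set R := (1 - δ) / δ
  have hR : R * δ = 1 - δ := div_mul_cancel₀ _ hδ.ne'
  set η := δ ^ 2 / R ^ 6
  -- One constant per regime; `N` makes $n$ positive and the lower bound on $\psi''$ at least
  -- 12000000. Positivity of `η` matters only in the first regime, where $\delta\le k\le 1-\delta$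
  -- forces $\delta\le 1/2$; at $\delta=1$ the quotients defining `η` and `12000000 / η` have
  -- divisor zero and default to 0.
  refine ⟨max (12000000 / η) (12000000 / δ), max 1 ⌈max (12000000 / η) (12000000 / δ)⌉₊, ?_⟩
  intro n hn p k hm
  have hn0 : 0 < n := (le_max_left _ _).trans hn
  have hnC : max (12000000 / η) (12000000 / δ) ≤ n :=
    Nat.ceil_le.1 ((le_max_right _ _).trans hn)
  refine ⟨fun hp hk0 hk1 => ?_, fun t ht hs a => ?_⟩
  · have hδ2 : δ ≤ 1 / 2 := by linarith
    have hη : 0 < η := by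
      have : 0 < R := div_pos (by linarith) hδ
      positivity
    obtain ⟨h1, h2⟩ := existsUnique_isSaddlePoint hδ hδ2 hR hn0 p hp hk0 hk1
    refine ⟨h1, fun t ht a => ?_⟩
    obtain ⟨ε, he, h⟩ := exists_relative_error_of_mul_le hη ((le_max_left _ _).trans hnC) p hm ht
      (h2 t ht) a
    exact ⟨ε, he.trans (by gcongr; exact le_max_left _ _), h⟩
  · obtain ⟨ε, he, h⟩ := exists_relative_error_of_mul_le hδ ((le_max_right _ _).trans hnC) p hm ht
      hs a
    exact ⟨ε, he.trans (by gcongr; exact le_max_right _ _), h⟩
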